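/- Let $A=(a_{ij})_{0\le i,j\le n}$ be an affine Cartan matrix of any type, twisted types included (that is, an indecomposable symmetrizable generalized Cartan matrix whose symmetrization is positive semidefinite and singular). Let $V^\vee$ be the real coweight space with basis the fundamental coweights $\Lambda_0^\vee,\dots,\Lambda_n^\vee$. Let $\alpha_0,\dots,\alpha_n$ be the simple roots, which form the dual basis of linear forms on $V^\vee$, and let $\alpha_i^\vee=\sum_j a_{ij}\Lambda_j^\vee$ be the simple coroots. Put $s_i(x)=x-\langle\alpha_i,x\rangle\alpha_i^\vee$ and let $W=\langle s_0,\dots,s_n\rangle$ be the affine Weyl group. It preserves the level-zero hyperplane $V^\vee_0=\{x:\langle\delta,x\rangle=0\}$, where $\delta=\sum_j u_j\alpha_j$ is the null root ($Au=0$, $u\neq0$). Let $\mathrm{cl}$ be the restriction of the action of $W$ to $V^\vee_0$, and let $\mathring W=\mathrm{cl}(W)$ be the classical Weyl group. Let $C$ be a chamber of $V^\vee_0$, i.e. a connected component of the complement in $V^\vee_0$ of the hyperplanes $H_\alpha=\{\langle\alpha,x\rangle=0\}$, $\alpha\in\bigcup_i W\alpha_i$. Taking $C$ as fundamental chamber,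 let $w\in\mathring W$ correspond to the chamber $w^{-1}(C)$. (In the usual setting, node $0$ is special and $C=\{\alpha_1,\dots,\alpha_n>0\}$.) The level-zero right action on $\mathring W$ of the generators $\pi_0,\dots,\pi_n$ of the $0$-Hecke algebra of $W$ is defined by $$w.\pi_i=\begin{cases} w\,\mathrm{cl}(s_i) & \text{if } \langle\alpha_i,x\rangle>0 \text{ for all } x\in w^{-1}(C),\\ w & \text{otherwise.}\end{cases}$$ Theorem. The operators $\pi_0,\dots,\pi_n$ act transitively on $\mathring W$: for all $v,w\in\mathring W$ there is a finite sequence $i_1,\dots,i_k\in\{0,\dots,n\}$ with $v.\pi_{i_1}\cdots\pi_{i_k}=w$. Equivalently, the directed graph on $\mathring W$ with edges $w\to w.\pi_i$ ($0\le i\le n$) is strongly connected. -/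

import Mathlib

open scoped Matrix

/-- An affine (generalized) Cartan matrix, with rows and columns numbered `0, …, n`: an
indecomposable, symmetrizable generalized Cartan matrix whose symmetrization is positive
semidefinite and singular. All untwisted and all twisted affine types are included.
The entry `A i j` is `⟨α_i^∨, α_j⟩`. -/
structure AffineCartanMatrix (n : ℕ) where
  A : Matrix (Fin (n + 1)) (Fin (n + 1)) ℤ
  diag : ∀ i, A i i = 2
  nonpos : ∀ i j, i ≠ j → A i j ≤ 0
  zero_symm : ∀ i j, A i j = 0 → A j i = 0
  indecomposable : ∀ S : Set (Fin (n + 1)), S.Nonempty → Sᶜ.Nonempty →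
    ∃ i ∈ S, ∃ j ∈ Sᶜ, A i j ≠ 0
  posSemidef : ∃ d : Fin (n + 1) → ℝ, (∀ i, 0 < d i) ∧
    (Matrix.diagonal d * A.map (fun z : ℤ => (z : ℝ))).PosSemidef
  det_eq_zero : A.det = 0

namespace AffineCartanMatrix

noncomputable section

variable {n : ℕ}

/-- The real coweight space, with basis the fundamental coweights `Λ_0^∨, …, Λ_n^∨`: the
coordinate `x i` of a coweight `x` is `⟨α_i, x⟩`. -/
abbrev CoweightSpace (_A : AffineCartanMatrix n) : Type := Fin (n + 1) → ℝ

variable (A : AffineCartanMatrix n)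

/-- The simple root `α_i`, as a linear form on the coweight space. -/
def simpleRoot (i : Fin (n + 1)) : Module.Dual ℝ A.CoweightSpace := LinearMap.proj i

/-- The simple coroot `α_i^∨`, an element of the coweight space. -/
def simpleCoroot (i : Fin (n + 1)) : A.CoweightSpace := fun j => (A.A i j : ℝ)

lemma simpleRoot_simpleCoroot (i : Fin (n + 1)) : A.simpleRoot i (A.simpleCoroot i) = 2 := by
  simp [simpleRoot, simpleCoroot, A.diag]

/-- The simple reflection `s_i : x ↦ x - ⟨α_i, x⟩ α_i^∨` of the coweight space. -/
def simpleReflection (i : Fin (n + 1)) : A.CoweightSpace ≃ₗ[ℝ] A.CoweightSpace :=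
  Module.reflection (A.simpleRoot_simpleCoroot i)

/-- The affine Weyl group `W`, generated by `s_0, …, s_n`. -/
def weylGroup : Subgroup (A.CoweightSpace ≃ₗ[ℝ] A.CoweightSpace) :=
  Subgroup.closure (Set.range A.simpleReflection)

lemma simpleReflection_mem (i : Fin (n + 1)) : A.simpleReflection i ∈ A.weylGroup :=
  Subgroup.subset_closure ⟨i, rfl⟩

/-- The (real) roots of `W`: the linear forms `u(α_i)` with `u ∈ W`. (The contragredient action
of `u` is `α ↦ α ∘ u⁻¹`, and `u⁻¹` runs over `W` when `u` does.) -/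
def roots : Set (Module.Dual ℝ A.CoweightSpace) :=
  {α | ∃ u ∈ A.weylGroup, ∃ i, α = A.simpleRoot i ∘ₗ u.toLinearMap}

/-- The hyperplane of coweights of level zero: those on which the null root `δ` vanishes, where
`δ = ∑ j, u j • α_j` spans the line of combinations of simple roots with `A u = 0`. -/
def levelZero : Submodule ℝ A.CoweightSpace where
  carrier := {x | ∀ u : Fin (n + 1) → ℝ,
    A.A.map (fun z : ℤ => (z : ℝ)) *ᵥ u = 0 → u ⬝ᵥ x = 0}
  zero_mem' := fun u _ => by simp
  add_mem' := fun hx hy u hu => by rw [dotProduct_add, hx u hu, hy u hu, add_zero]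
  smul_mem' := fun c x hx u hu => by rw [dotProduct_smul, hx u hu, smul_zero]

lemma simpleCoroot_mem_levelZero (i : Fin (n + 1)) : A.simpleCoroot i ∈ A.levelZero := by
  intro u hu
  rw [dotProduct_comm]
  exact congrFun hu i

lemma apply_mem_levelZero {u : A.CoweightSpace ≃ₗ[ℝ] A.CoweightSpace} (hu : u ∈ A.weylGroup) :
    ∀ x ∈ A.levelZero, u x ∈ A.levelZero := by
  have key : ∀ i, ∀ x ∈ A.levelZero, A.simpleReflection i x ∈ A.levelZero := by
    intro i x hx
    rw [simpleReflection, Module.reflection_apply]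
    exact A.levelZero.sub_mem hx (A.levelZero.smul_mem _ (A.simpleCoroot_mem_levelZero i))
  refine Subgroup.closure_induction'' (p := fun u _ => ∀ x ∈ A.levelZero, u x ∈ A.levelZero)
    ?_ ?_ ?_ ?_ hu
  · rintro _ ⟨i, rfl⟩; exact key i
  · rintro _ ⟨i, rfl⟩
    have : (A.simpleReflection i)⁻¹ = A.simpleReflection i := by
      ext1 x
      exact (LinearEquiv.symm_apply_eq _).2
        (Module.involutive_reflection (A.simpleRoot_simpleCoroot i) x).symm
    rw [this]; exact key i
  · intro x hx; exact hx
  · intro u v _ _ h₁ h₂ x hx; exact h₁ _ (h₂ x hx)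

/-- The level-zero action `cl` of the affine Weyl group: restriction to the hyperplane of
coweights of level zero. -/
def cl : A.weylGroup →* (A.levelZero ≃ₗ[ℝ] A.levelZero) where
  toFun u :=
    { toFun := fun x => ⟨u.1 x, A.apply_mem_levelZero u.2 x x.2⟩
      invFun := fun x => ⟨(u⁻¹).1 x, A.apply_mem_levelZero (u⁻¹).2 x x.2⟩
      map_add' := fun x y => Subtype.ext (map_add u.1 x.1 y.1)
      map_smul' := fun c x => Subtype.ext (map_smul u.1 c x.1)
      left_inv := fun x => Subtype.ext (u.1.symm_apply_apply x.1)
      right_inv := fun x => Subtype.ext (u.1.apply_symm_apply x.1) }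
  map_one' := rfl
  map_mul' _ _ := rfl

/-- The classical Weyl group `W̊ = cl(W)`. -/
def classicalWeylGroup : Subgroup (A.levelZero ≃ₗ[ℝ] A.levelZero) := A.cl.range

/-- The element `cl(s_i)` of the classical Weyl group. -/
def clReflection (i : Fin (n + 1)) : A.classicalWeylGroup :=
  ⟨A.cl ⟨A.simpleReflection i, A.simpleReflection_mem i⟩, ⟨_, rfl⟩⟩

/-- The points of the level-zero hyperplane that lie on no root hyperplane `H_α`. -/
def regularPoints : Set A.levelZero := {x | ∀ α ∈ A.roots, α (x : A.CoweightSpace) ≠ 0}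

/-- The chambers of the level-zero hyperplane: the connected components of the complement of the
root hyperplanes. -/
def IsChamber (C : Set A.levelZero) : Prop :=
  ∃ x ∈ A.regularPoints, C = connectedComponentIn A.regularPoints x

/-- The open half-space `H_i^+` of the level-zero hyperplane, where `α_i` is positive. -/
def posHalfSpace (i : Fin (n + 1)) : Set A.levelZero :=
  {x | 0 < A.simpleRoot i (x : A.CoweightSpace)}

open Classical in
/-- The level-zero (right) action `w ↦ w.π_i` of the generator `π_i` of the `0`-Hecke algebra on
the classical Weyl group, for `i = 0, …, n`. Once a fundamental chamber `C` is fixed, `w ∈ W̊`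
stands for the chamber `w⁻¹(C)`, and `w.s_i = w s_i` for the chamber `s_i(w⁻¹(C))`. The operator
`π_i` folds `H_i^+` onto `H_i^-` along `s_i` and fixes `H_i^-`: it sends `w` to `w s_i` if the
chamber of `w` lies in `H_i^+` (equivalently `w(α_i)` is positive on `C`; for `C` the chamber of
`α_1, …, α_n > 0` and `i ≠ 0` this says that `i` is not a right descent of `w`), and fixes `w`
otherwise. -/
def piOp (C : Set A.levelZero) (i : Fin (n + 1)) (w : A.classicalWeylGroup) :
    A.classicalWeylGroup :=
  if (w⁻¹).1 '' C ⊆ A.posHalfSpace i then w * A.clReflection i else w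

/-- The edges `w → w.π_i`, for `i = 0, …, n`, of the graph of the level-zero action. -/
def Edge (C : Set A.levelZero) (v w : A.classicalWeylGroup) : Prop :=
  ∃ i, A.piOp C i v = w

end

end AffineCartanMatrix

namespace AffineCartanMatrix

variable {n : ℕ} (A : AffineCartanMatrix n)

/-! Let `S` be stable under all `π_i`, fix a regular point `x` of `C`, and put `y = ∑_{w ∈ S} w⁻¹x`.
In `⟨α_i, y⟩` the terms of `w` and `w s_i` cancel if both lie in `S`; if only `w` does, stability
forces `⟨α_i, w⁻¹x⟩ < 0`. So `⟨α_i, y⟩ ≤ 0`, with equality only if `S` is stable under `s_i`. But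
`⟨δ, y⟩ = 0` and `δ` is a positive combination of the `α_i`, so equality holds for every `i`
(`mul_clReflection_mem_iff`). The `cl(s_i)` generate the group, so a nonempty `S` is everything;
take for `S` the set reachable from `v`. The sum needs a finite group: coroot orbits are integral
and bounded, and coroots span level zero. Positivity of `δ` is `exists_pos_mulVec_eq_zero`. -/

/-- The Cartan matrix with real entries. -/
abbrev realMatrix : Matrix (Fin (n + 1)) (Fin (n + 1)) ℝ := A.A.map (fun z : ℤ => (z : ℝ))

lemma simpleReflection_apply (i : Fin (n + 1)) (x : A.CoweightSpace) :
    A.simpleReflection i x = x - x i • A.simpleCoroot i := by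
  rw [simpleReflection, Module.reflection_apply]; rfl

lemma simpleRoot_simpleReflection (i : Fin (n + 1)) (x : A.CoweightSpace) :
    A.simpleRoot i (A.simpleReflection i x) = -A.simpleRoot i x := by
  have h := A.simpleRoot_simpleCoroot i
  rw [simpleReflection_apply, map_sub, map_smul, h]
  simp only [simpleRoot, LinearMap.proj_apply, smul_eq_mul]
  ring

lemma simpleReflection_mul_self (i : Fin (n + 1)) :
    A.simpleReflection i * A.simpleReflection i = 1 :=
  LinearEquiv.ext (Module.involutive_reflection (A.simpleRoot_simpleCoroot i))

lemma clReflection_mul_self (i : Fin (n + 1)) : A.clReflection i * A.clReflection i = 1 := by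
  apply Subtype.ext
  change A.cl _ * A.cl _ = 1
  rw [← map_mul, ← map_one A.cl]
  exact congrArg A.cl (Subtype.ext (A.simpleReflection_mul_self i))

lemma clReflection_inv (i : Fin (n + 1)) : (A.clReflection i)⁻¹ = A.clReflection i :=
  inv_eq_of_mul_eq_one_left (A.clReflection_mul_self i)

lemma simpleRoot_mul_clReflection_inv (i : Fin (n + 1)) (w : A.classicalWeylGroup)
    (x : A.levelZero) :
    A.simpleRoot i ((w * A.clReflection i)⁻¹.1 x : A.levelZero) =
      -A.simpleRoot i (w⁻¹.1 x : A.levelZero) := by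
  rw [mul_inv_rev, clReflection_inv]
  exact A.simpleRoot_simpleReflection i _

/-! ### The null root has positive coefficients -/

/-- Perron–Frobenius style: taking absolute values of a kernel vector keeps it in the kernel, and
indecomposability excludes zero coordinates. -/
lemma exists_pos_mulVec_eq_zero :
    ∃ u : Fin (n + 1) → ℝ, (∀ i, 0 < u i) ∧ A.realMatrix *ᵥ u = 0 := by
  obtain ⟨d, hd, hB⟩ := A.posSemidef
  set B := Matrix.diagonal d * A.realMatrix with hBdef
  have hBij : ∀ i j, B i j = d i * (A.A i j : ℝ) := fun i j => by
    simp [hBdef, Matrix.diagonal_mul]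
  have hBA : ∀ v, B *ᵥ v = 0 → A.realMatrix *ᵥ v = 0 := by
    intro v hv
    rw [hBdef, ← Matrix.mulVec_mulVec] at hv
    funext i
    have := congrFun hv i
    rw [Matrix.mulVec_diagonal] at this
    exact (mul_eq_zero.1 this).resolve_left (hd i).ne'
  have hdet : A.realMatrix.det = 0 := by
    have := (Int.castRingHom ℝ).map_det A.A
    rw [A.det_eq_zero] at this
    simpa using this.symm
  obtain ⟨v, hv0, hv⟩ := Matrix.exists_mulVec_eq_zero_iff.2 hdet
  have hBv : B *ᵥ v = 0 := by rw [hBdef, ← Matrix.mulVec_mulVec, hv, Matrix.mulVec_zero]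
  have habs : B *ᵥ |v| = 0 := by
    -- Off-diagonal entries are nonpositive, so the form at `|v|` is at most its value at `v`, which
    -- is 0.
    refine (hB.dotProduct_mulVec_zero_iff _).1 (le_antisymm ?_ (hB.dotProduct_mulVec_nonneg _))
    have h0 : v ⬝ᵥ B *ᵥ v = 0 := by rw [hBv, dotProduct_zero]
    rw [← h0]
    simp only [star_trivial, dotProduct, Matrix.mulVec, Finset.mul_sum, Pi.abs_apply]
    refine Finset.sum_le_sum fun i _ => Finset.sum_le_sum fun j _ => ?_
    rw [hBij]
    by_cases hij : i = j
    · subst hij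
      have := abs_mul_abs_self (v i)
      exact le_of_eq (by linear_combination (d i * (A.A i i : ℝ)) * this)
    · have h1 : (A.A i j : ℝ) ≤ 0 := by exact_mod_cast A.nonpos i j hij
      have h2 : v i * v j ≤ |v i| * |v j| := by rw [← abs_mul]; exact le_abs_self _
      have h3 : d i * (A.A i j : ℝ) ≤ 0 := mul_nonpos_of_nonneg_of_nonpos (hd i).le h1
      linarith [mul_le_mul_of_nonpos_left h2 h3]
  refine ⟨|v|, ?_, hBA _ habs⟩
  by_contra! hcon
  obtain ⟨i₀, hi₀⟩ := hcon
  obtain ⟨j₀, hj₀⟩ := Function.ne_iff.1 hv0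
  -- At a zero `i` of `v`, row `i` of `A|v| = 0` is a sum of nonpositive terms, so each vanishes,
  -- contradicting `A i j ≠ 0`, `v j ≠ 0`.
  obtain ⟨i, hi, j, hj, hij⟩ := A.indecomposable {i | v i = 0}
    ⟨i₀, abs_nonpos_iff.1 hi₀⟩ ⟨j₀, hj₀⟩
  have hvi : v i = 0 := hi
  have hvj : v j ≠ 0 := hj
  have hsum : ∑ k, (A.A i k : ℝ) * |v k| = 0 := congrFun (hBA _ habs) i
  have hle : ∀ k ∈ Finset.univ, (A.A i k : ℝ) * |v k| ≤ 0 := by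
    intro k _
    by_cases hik : i = k
    · simp [← hik, hvi]
    · exact mul_nonpos_of_nonpos_of_nonneg (by exact_mod_cast A.nonpos i k hik) (abs_nonneg _)
  have := (Finset.sum_eq_zero_iff_of_nonpos hle).1 hsum j (Finset.mem_univ j)
  rcases mul_eq_zero.1 this with h | h
  · exact hij (by exact_mod_cast h)
  · exact hvj (abs_eq_zero.1 h)

/-! ### Finiteness of the classical Weyl group -/

/-- Level zero is the annihilator of the kernel of `A`, that is, the row space of `A`, and the
coroots are the rows. -/
lemma exists_eq_sum_simpleCoroot {x : A.CoweightSpace} (hx : x ∈ A.levelZero) :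
    ∃ c : Fin (n + 1) → ℝ, x = ∑ i, c i • A.simpleCoroot i := by
  let φ : Module.Dual ℝ (Fin (n + 1) → ℝ) := dotProductBilin ℝ ℝ x
  have hφ : φ ∈ LinearMap.range A.realMatrix.mulVecLin.dualMap := by
    rw [LinearMap.range_dualMap_eq_dualAnnihilator_ker, Submodule.mem_dualAnnihilator]
    intro u hu
    change x ⬝ᵥ u = 0
    rw [dotProduct_comm]
    exact hx u hu
  obtain ⟨ψ, hψ⟩ := hφ
  refine ⟨fun i => ψ (Pi.single i 1), ?_⟩
  funext j
  have h := LinearMap.congr_fun hψ (Pi.single j 1)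
  have h1 : φ (Pi.single j 1) = x j := by
    change x ⬝ᵥ Pi.single j 1 = x j
    simp
  rw [h1, LinearMap.dualMap_apply, Matrix.mulVecLin_apply, Matrix.mulVec_single_one,
    LinearMap.pi_apply_eq_sum_univ ψ] at h
  rw [← h]
  simp only [simpleCoroot, Finset.sum_apply, Pi.smul_apply, smul_eq_mul, Matrix.col_apply,
    Matrix.map_apply]
  refine Finset.sum_congr rfl fun i _ => ?_
  rw [mul_comm]
  congr 2
  funext k
  simp [Pi.single_apply, eq_comm]

lemma weylGroup_induction {p : A.CoweightSpace → Prop}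
    (hp : ∀ i x, p x → p (A.simpleReflection i x))
    {u : A.CoweightSpace ≃ₗ[ℝ] A.CoweightSpace} (hu : u ∈ A.weylGroup) :
    ∀ x, p x → p (u x) := by
  refine Subgroup.closure_induction'' (p := fun u _ => ∀ x, p x → p (u x)) ?_ ?_ ?_ ?_ hu
  · rintro _ ⟨i, rfl⟩; exact hp i
  · rintro _ ⟨i, rfl⟩
    rw [inv_eq_of_mul_eq_one_left (A.simpleReflection_mul_self i)]; exact hp i
  · exact fun x hx => hx
  · exact fun u v _ _ h₁ h₂ x hx => h₁ _ (h₂ x hx)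

lemma exists_intCast_eq {u : A.CoweightSpace ≃ₗ[ℝ] A.CoweightSpace} (hu : u ∈ A.weylGroup)
    (i : Fin (n + 1)) : ∃ z : Fin (n + 1) → ℤ, u (A.simpleCoroot i) = fun j => (z j : ℝ) := by
  refine A.weylGroup_induction (p := fun x => ∃ z : Fin (n + 1) → ℤ, x = fun j => (z j : ℝ))
    ?_ hu _ ⟨A.A i, rfl⟩
  rintro k _ ⟨z, rfl⟩
  refine ⟨fun j => z j - z k * A.A k j, ?_⟩
  rw [simpleReflection_apply]
  funext j
  simp [simpleCoroot]

/-- The orbits of the simple coroots are bounded: the Weyl group preserves the quadratic form of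
the symmetrization, which is positive definite on the level-zero hyperplane. -/
lemma exists_abs_apply_simpleCoroot_le : ∃ M : ℝ, ∀ u ∈ A.weylGroup, ∀ i j,
    |u (A.simpleCoroot i) j| ≤ M := by
  obtain ⟨d, hd, hB⟩ := A.posSemidef
  set B := Matrix.diagonal d * A.realMatrix with hBdef
  have hBij : ∀ i j, B i j = d i * (A.A i j : ℝ) := fun i j => by
    simp [hBdef, Matrix.diagonal_mul]
  have hsymm : ∀ i j, B i j = B j i := fun i j => by
    simpa using (hB.isHermitian.apply i j).symm
  have hcol : ∀ i, B *ᵥ Pi.single i (d i)⁻¹ = A.simpleCoroot i := by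
    intro i
    funext j
    have := (hd i).ne'
    rw [Matrix.mulVec_single]
    simp only [Pi.smul_apply, MulOpposite.smul_eq_mul_unop, MulOpposite.unop_op, Matrix.col_apply,
      simpleCoroot]
    rw [hsymm, hBij]
    field_simp
  have hpair : ∀ (e : Fin (n + 1) → ℝ) i (a : ℝ), Pi.single i a ⬝ᵥ B *ᵥ e = a * (B *ᵥ e) i := by
    intro e i a
    rw [single_dotProduct]
  have hcoroot : ∀ (e : Fin (n + 1) → ℝ) i, e ⬝ᵥ A.simpleCoroot i = (d i)⁻¹ * (B *ᵥ e) i := by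
    intro e i
    have ht : Bᵀ = B := by ext i j; exact hsymm j i
    rw [← hcol, Matrix.dotProduct_mulVec, ← Matrix.mulVec_transpose, ht, dotProduct_comm,
      single_dotProduct]
  -- The invariant form on `x = B e` is `e ⬝ᵥ B e`. Reflections are lifted to `e`, and `2 / d i` is
  -- the value at the lift `e_i / d i` of the `i`-th coroot.
  have hinv : ∀ u ∈ A.weylGroup, ∀ i, ∃ e, u (A.simpleCoroot i) = B *ᵥ e ∧
      e ⬝ᵥ B *ᵥ e = 2 * (d i)⁻¹ := by
    intro u hu i
    refine A.weylGroup_induction (p := fun x => ∃ e, x = B *ᵥ e ∧ e ⬝ᵥ B *ᵥ e = 2 * (d i)⁻¹)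
      ?_ hu _ ⟨Pi.single i (d i)⁻¹, (hcol i).symm, ?_⟩
    · rintro k _ ⟨e, rfl, he⟩
      refine ⟨e - (B *ᵥ e) k • Pi.single k (d k)⁻¹, ?_, ?_⟩
      · rw [simpleReflection_apply, Matrix.mulVec_sub, Matrix.mulVec_smul, hcol]
      · rw [Matrix.mulVec_sub, Matrix.mulVec_smul, sub_dotProduct, dotProduct_sub, dotProduct_sub,
          smul_dotProduct, smul_dotProduct, dotProduct_smul, dotProduct_smul, hcol,
          hcoroot, hpair, single_dotProduct, he]
        simp only [simpleCoroot, A.diag, smul_eq_mul]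
        push_cast
        ring
    · rw [hpair, hcol]
      simp only [simpleCoroot, A.diag]
      push_cast
      ring
  refine ⟨∑ i, ∑ j, (1 + d j * (d i)⁻¹ * 4), fun u hu i j => ?_⟩
  obtain ⟨e, hue, he⟩ := hinv u hu i
  have hpos : ∀ a b, 0 ≤ 1 + d b * (d a)⁻¹ * 4 := fun a b => by
    have := hd a; have := hd b; positivity
  refine le_trans ?_ ((Finset.single_le_sum (f := fun j => 1 + d j * (d i)⁻¹ * 4)
    (fun b _ => hpos i b) (Finset.mem_univ j)).trans
    (Finset.single_le_sum (f := fun i => ∑ j, (1 + d j * (d i)⁻¹ * 4))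
      (fun a _ => Finset.sum_nonneg fun b _ => hpos a b) (Finset.mem_univ i)))
  set t := (B *ᵥ e) j with ht
  rw [hue, ← ht]
  -- Cauchy–Schwarz: `t / 2` minimizes the form along the line through `e`, giving `t² ≤ 4 d_j /
  -- d_i`.
  have hcs := hB.dotProduct_mulVec_nonneg (e - (t / 2) • Pi.single j (d j)⁻¹)
  rw [star_trivial, Matrix.mulVec_sub, Matrix.mulVec_smul, sub_dotProduct, dotProduct_sub,
    dotProduct_sub, smul_dotProduct, smul_dotProduct, dotProduct_smul, dotProduct_smul, hcol,
    hcoroot, hpair, single_dotProduct, he, ← ht] at hcs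
  simp only [simpleCoroot, A.diag, smul_eq_mul] at hcs
  push_cast at hcs
  have hcs' : t ^ 2 ≤ d j * (d i)⁻¹ * 4 := by
    have h := mul_le_mul_of_nonneg_left hcs (hd j).le
    have hdj := mul_inv_cancel₀ (hd j).ne'
    have : d j * (2 * (d i)⁻¹) - t ^ 2 / 2 * (d j * (d j)⁻¹) ≥ 0 := by linarith
    rw [hdj] at this
    linarith
  nlinarith [sq_nonneg (|t| - 1), sq_abs t, abs_nonneg t]

instance : Finite A.classicalWeylGroup := by
  obtain ⟨M, hM⟩ := A.exists_abs_apply_simpleCoroot_le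
  -- An element is determined by its images of the spanning coroots, whose coordinates are integers
  -- in a bounded range.
  let F : A.classicalWeylGroup → Fin (n + 1) → Fin (n + 1) → ℝ := fun w i =>
    (w.1 ⟨A.simpleCoroot i, A.simpleCoroot_mem_levelZero i⟩ : A.levelZero)
  have hF : Function.Injective F := by
    intro v w hvw
    refine Subtype.ext (LinearEquiv.ext fun x => ?_)
    obtain ⟨c, hc⟩ := A.exists_eq_sum_simpleCoroot x.2
    have hx : x = ∑ i, c i • (⟨A.simpleCoroot i, A.simpleCoroot_mem_levelZero i⟩ : A.levelZero) :=
      Subtype.ext (by simpa using hc)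
    rw [hx, map_sum, map_sum]
    refine Finset.sum_congr rfl fun i _ => ?_
    rw [map_smul, map_smul]
    exact congrArg _ (Subtype.ext (congrFun hvw i))
  let T : Set ℝ := (fun z : ℤ => (z : ℝ)) '' Set.Icc (-⌈M⌉) ⌈M⌉
  have hT : T.Finite := (Set.finite_Icc _ _).image _
  have hfin : (Set.univ.pi fun _ : Fin (n + 1) => Set.univ.pi fun _ : Fin (n + 1) => T).Finite :=
    Set.Finite.pi fun _ => Set.Finite.pi fun _ => hT
  refine Set.finite_univ_iff.1 (Set.Finite.of_finite_image (f := F)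
    (hfin.subset ?_) hF.injOn)
  rintro _ ⟨⟨_, ⟨u, rfl⟩⟩, -, rfl⟩ i - j -
  obtain ⟨z, hz⟩ := A.exists_intCast_eq u.2 i
  have hb := hM u.1 u.2 i j
  have hFz : F ⟨A.cl u, ⟨u, rfl⟩⟩ i j = (z j : ℝ) := congrFun hz j
  replace hb : |(z j : ℝ)| ≤ M := by simpa only [hz] using hb
  rw [hFz]
  have hb' := abs_le.1 (hb.trans (Int.le_ceil M))
  exact ⟨z j, ⟨by exact_mod_cast hb'.1, by exact_mod_cast hb'.2⟩, rfl⟩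

/-! ### Chambers and half-spaces -/

lemma simpleRoot_mem_roots (i : Fin (n + 1)) : A.simpleRoot i ∈ A.roots :=
  ⟨1, one_mem _, i, rfl⟩

lemma apply_mem_regularPoints (w : A.classicalWeylGroup) {x : A.levelZero}
    (hx : x ∈ A.regularPoints) : w.1 x ∈ A.regularPoints := by
  obtain ⟨_, ⟨u, rfl⟩⟩ := w
  rintro _ ⟨v, hv, i, rfl⟩
  exact hx _ ⟨v * u.1, mul_mem hv u.2, i, rfl⟩

/-- A root has no zero on a chamber, hence constant sign by connectedness; one base point thus
decides the case in `piOp`. -/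
lemma image_subset_posHalfSpace_iff {C : Set A.levelZero} (hC : IsPreconnected C)
    (hreg : C ⊆ A.regularPoints) {x : A.levelZero} (hx : x ∈ C) (i : Fin (n + 1))
    (w : A.classicalWeylGroup) :
    w.1 '' C ⊆ A.posHalfSpace i ↔ 0 < A.simpleRoot i (w.1 x : A.levelZero) := by
  refine ⟨fun h => h ⟨x, hx, rfl⟩, fun h => ?_⟩
  rintro _ ⟨y, hy, rfl⟩
  let f : A.levelZero →ₗ[ℝ] ℝ := A.simpleRoot i ∘ₗ A.levelZero.subtype ∘ₗ w.1.toLinearMap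
  have hf : Continuous f := f.continuous_of_finiteDimensional
  by_contra hneg
  have hneg : f y ≤ 0 := not_lt.1 hneg
  obtain ⟨z, hz, hz0⟩ := hC.intermediate_value hy hx hf.continuousOn ⟨hneg, le_of_lt h⟩
  exact A.apply_mem_regularPoints w (hreg hz) _ (A.simpleRoot_mem_roots i) hz0

/-! ### Transitivity -/

/-- A set of elements that is stable under all `π_i` is stable under all simple reflections: the
sum of the corresponding points pairs nonpositively with each `α_i`, and trivially with `δ`. -/
lemma mul_clReflection_mem_iff {C : Set A.levelZero} (hC : A.IsChamber C)
    {S : Set A.classicalWeylGroup} (hS : ∀ i, ∀ w ∈ S, A.piOp C i w ∈ S) (i : Fin (n + 1))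
    (w : A.classicalWeylGroup) : w * A.clReflection i ∈ S ↔ w ∈ S := by
  classical
  have := Fintype.ofFinite A.classicalWeylGroup
  obtain ⟨x, hx, rfl⟩ := hC
  set C := connectedComponentIn A.regularPoints x
  have hreg : C ⊆ A.regularPoints := connectedComponentIn_subset _ _
  have hxC : x ∈ C := mem_connectedComponentIn hx
  let f : Fin (n + 1) → A.classicalWeylGroup → ℝ := fun i w =>
    A.simpleRoot i (w⁻¹.1 x : A.levelZero)
  let χ : A.classicalWeylGroup → ℝ := fun w => if w ∈ S then 1 else 0
  have hfs : ∀ i w, f i (w * A.clReflection i) = -f i w := fun i w =>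
    A.simpleRoot_mul_clReflection_inv i w x
  have hf0 : ∀ i w, f i w ≠ 0 := fun i w =>
    A.apply_mem_regularPoints w⁻¹ hx _ (A.simpleRoot_mem_roots i)
  have hss : ∀ i w, w * A.clReflection i * A.clReflection i = w := fun i w => by
    rw [mul_assoc, clReflection_mul_self, mul_one]
  have hstep : ∀ i w, 0 < f i w → w ∈ S → w * A.clReflection i ∈ S := by
    intro i w hw hwS
    have h := hS i w hwS
    rwa [piOp, if_pos] at h
    exact (A.image_subset_posHalfSpace_iff isPreconnected_connectedComponentIn hreg hxC i w⁻¹).2 hw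
  have hχ : ∀ i w, 0 < f i w → χ w ≤ χ (w * A.clReflection i) := by
    intro i w hw
    by_cases hwS : w ∈ S
    · simp [χ, hwS, hstep i w hw hwS]
    · simp only [χ, hwS, if_false]; split_ifs <;> norm_num
  -- The first factor is nonzero only if exactly one of `w`, `w s_i` lies in `S`, and that one is on
  -- the negative side of `α_i`.
  have hterm : ∀ i w, (χ w - χ (w * A.clReflection i)) * f i w ≤ 0 := by
    intro i w
    rcases (hf0 i w).lt_or_gt with h | h
    · have := hχ i (w * A.clReflection i) (by rw [hfs]; linarith)
      rw [hss] at this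
      exact mul_nonpos_of_nonneg_of_nonpos (by linarith) h.le
    · exact mul_nonpos_of_nonpos_of_nonneg (by linarith [hχ i w h]) h.le
  have hsum : ∀ i, 2 * ∑ w, χ w * f i w =
      ∑ w, (χ w - χ (w * A.clReflection i)) * f i w := by
    intro i
    -- Reindexing by `w ↦ w s_i` flips the sign of `f i`; averaging with the original sum yields the
    -- factor 2.
    have h := Equiv.sum_comp (Equiv.mulRight (A.clReflection i)) fun w => χ w * f i w
    simp only [Equiv.coe_mulRight, hfs, mul_neg, Finset.sum_neg_distrib] at h
    simp only [sub_mul, Finset.sum_sub_distrib]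
    linarith
  obtain ⟨u, hu, hAu⟩ := A.exists_pos_mulVec_eq_zero
  have hnull : ∀ w, ∑ i, u i * f i w = 0 := fun w => (w⁻¹.1 x).2 u hAu
  have htotal : ∑ i, u i * ∑ w, χ w * f i w = 0 := by
    simp only [Finset.mul_sum]
    rw [Finset.sum_comm]
    refine Finset.sum_eq_zero fun w _ => ?_
    simp only [mul_left_comm _ (χ w), ← Finset.mul_sum, hnull, mul_zero]
  have hle : ∀ i, ∑ w, χ w * f i w ≤ 0 := fun i => by
    have := Finset.sum_nonpos fun w (_ : w ∈ Finset.univ) => hterm i w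
    linarith [hsum i]
  have hi : ∑ w, χ w * f i w = 0 :=
    (mul_eq_zero.1 ((Finset.sum_eq_zero_iff_of_nonpos fun k _ =>
      mul_nonpos_of_nonneg_of_nonpos (hu k).le (hle k)).1 htotal i (Finset.mem_univ i))).resolve_left
      (hu i).ne'
  have hsi := hsum i
  rw [hi, mul_zero] at hsi
  -- A zero sum of nonpositive terms vanishes termwise; as `x` is regular, `f i w ≠ 0`, so `χ`
  -- agrees at `w` and `w s_i`.
  have hw := (Finset.sum_eq_zero_iff_of_nonpos fun w _ => hterm i w).1 hsi.symm w
    (Finset.mem_univ w)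
  have hχw := (mul_eq_zero.1 hw).resolve_right (hf0 i w)
  by_cases h1 : w ∈ S <;> by_cases h2 : w * A.clReflection i ∈ S <;> simp [χ, h1, h2] at hχw ⊢

lemma eq_univ_of_mul_clReflection_mem_iff {S : Set A.classicalWeylGroup} (hne : S.Nonempty)
    (hS : ∀ i w, w * A.clReflection i ∈ S ↔ w ∈ S) : S = Set.univ := by
  have key : ∀ u (hu : u ∈ A.weylGroup), ∀ w : A.classicalWeylGroup,
      w * ⟨A.cl ⟨u, hu⟩, ⟨_, rfl⟩⟩ ∈ S ↔ w ∈ S := by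
    intro u hu
    refine Subgroup.closure_induction (p := fun u hu => ∀ w : A.classicalWeylGroup,
      w * ⟨A.cl ⟨u, hu⟩, ⟨_, rfl⟩⟩ ∈ S ↔ w ∈ S) ?_ ?_ ?_ ?_ hu
    · rintro _ ⟨i, rfl⟩; exact hS i
    · exact fun w => Iff.rfl
    · exact fun u v _ _ h₁ h₂ w => (h₂ (w * ⟨A.cl ⟨u, _⟩, ⟨_, rfl⟩⟩)).trans (h₁ w)
    · intro u hu h w
      rw [← h]
      refine iff_of_eq (congrArg (· ∈ S) ?_)
      exact inv_mul_cancel_right w ⟨A.cl ⟨u, hu⟩, ⟨_, rfl⟩⟩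
  obtain ⟨v, hv⟩ := hne
  refine Set.eq_univ_of_forall fun w => ?_
  obtain ⟨u, hu⟩ := (v⁻¹ * w).2
  have hw : v * ⟨A.cl ⟨u.1, u.2⟩, ⟨_, rfl⟩⟩ = w := by
    have : (⟨A.cl ⟨u.1, u.2⟩, ⟨_, rfl⟩⟩ : A.classicalWeylGroup) = v⁻¹ * w := Subtype.ext hu
    rw [this, mul_inv_cancel_left]
  rw [← hw]
  exact (key u.1 u.2 v).2 hv

lemma exists_foldl_piOp_eq {C : Set A.levelZero} (hC : A.IsChamber C)
    (v w : A.classicalWeylGroup) :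
    ∃ l : List (Fin (n + 1)), l.foldl (fun u i => A.piOp C i u) v = w := by
  let S : Set A.classicalWeylGroup :=
    {w | ∃ l : List (Fin (n + 1)), l.foldl (fun u i => A.piOp C i u) v = w}
  have hS : ∀ i, ∀ w ∈ S, A.piOp C i w ∈ S := by
    rintro i _ ⟨l, rfl⟩
    exact ⟨l ++ [i], by simp⟩
  have h := A.eq_univ_of_mul_clReflection_mem_iff (S := S) ⟨v, [], rfl⟩
    (A.mul_clReflection_mem_iff hC hS)
  exact h.ge (Set.mem_univ w)

lemma reflTransGen_foldl_piOp (C : Set A.levelZero) (l : List (Fin (n + 1)))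
    (v : A.classicalWeylGroup) :
    Relation.ReflTransGen (A.Edge C) v (l.foldl (fun u i => A.piOp C i u) v) := by
  induction l generalizing v with
  | nil => exact .refl
  | cons i l ih => exact (ih _).head ⟨i, rfl⟩

end AffineCartanMatrix

theorem mainTheorem4 {n : ℕ} (A : AffineCartanMatrix n) (C : Set A.levelZero)
    (hC : A.IsChamber C) :
    (∀ v w : A.classicalWeylGroup, ∃ l : List (Fin (n + 1)),
      l.foldl (fun u i => A.piOp C i u) v = w) ∧
    (∀ v w : A.classicalWeylGroup, Relation.ReflTransGen (A.Edge C) v w) := by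
  refine ⟨A.exists_foldl_piOp_eq hC, fun v w => ?_⟩
  obtain ⟨l, rfl⟩ := A.exists_foldl_piOp_eq hC v w
  exact A.reflTransGen_foldl_piOp C l v
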